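/- For a metric space $(X,\rho)$ and an integer $m\ge 1$ let \[p_m(X)=\sup\{\varepsilon>0 : \text{there are } x_1,\dots,x_m\in X \text{ with } \rho(x_i,x_j)\ge\varepsilon \text{ for all } i\ne j\}\] (with $\sup\emptyset=0$). Let $S^d\subset\mathbb{R}^{d+1}$ be the unit sphere with its geodesic metric $\arccos\langle x,y\rangle$, and let $\mathbb{R}P^d$ be real projective space with the quotient metric under the antipodal action, i.e. the distance of two points is the angle in $[0,\pi/2]$ between the corresponding lines in $\mathbb{R}^{d+1}$. Theorem 1.1. Let $d\ge 0$ and $n\ge 1$ be integers, and let $V$ be an $n$-dimensional real vector space of continuous functions $f\colon S^d\to\mathbb{R}$ that are odd, i.e. $f(-x)=-f(x)$ for all $x\in S^d$. Then there is a set $A\subset S^d$ of diameter at most $\delta=\pi-p_{n+1}(\mathbb{R}P^d)$ such that for every $f\in V$ the restriction $f|_A$ is not strictly positive, i.e. there is $x\in A$ with $f(x)\le 0$. -/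

import Mathlib

/-- `p_n(X)`: the supremum of all `ε > 0` such that there are `n` points of `X` with pairwise
distances at least `ε`. -/
noncomputable def codeDistance (X : Type*) [MetricSpace X] (n : ℕ) : ℝ :=
  sSup {ε : ℝ | 0 < ε ∧ ∃ x : Fin n → X, ∀ i j : Fin n, i ≠ j → ε ≤ dist (x i) (x j)}

/-- The unit sphere `S^d` in `ℝ^(d+1)`. -/
abbrev UnitSphere (d : ℕ) : Type :=
  Metric.sphere (0 : EuclideanSpace ℝ (Fin (d + 1))) 1

/-- The geodesic distance on `S^d`: the angle `arccos ⟨x, y⟩`. -/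
noncomputable def UnitSphere.geodesicDist {d : ℕ} (x y : UnitSphere d) : ℝ :=
  InnerProductGeometry.angle (x : EuclideanSpace ℝ (Fin (d + 1))) y

/-- The set `A ⊆ S^d` has diameter at most `δ` in the geodesic metric. -/
def UnitSphere.DiamAtMost {d : ℕ} (A : Set (UnitSphere d)) (δ : ℝ) : Prop :=
  ∀ x ∈ A, ∀ y ∈ A, UnitSphere.geodesicDist x y ≤ δ

/-- Real projective space `ℝP^d`, the space of lines through the origin in `ℝ^(d+1)`. -/
def RealProjectiveSpace (d : ℕ) : Type :=
  Projectivization ℝ (EuclideanSpace ℝ (Fin (d + 1)))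

namespace RealProjectiveSpace

/-- The line spanned by a point of the sphere, i.e. the quotient map `S^d → ℝP^d`. -/
noncomputable def ofSphere {d : ℕ} (x : UnitSphere d) : RealProjectiveSpace d :=
  Projectivization.mk ℝ (x : EuclideanSpace ℝ (Fin (d + 1))) (ne_zero_of_mem_unit_sphere x)

/-- The angle between two lines: the smaller one of the angles `∠(v, w)` and
`∠(v, -w) = π - ∠(v, w)`, where `v` and `w` span the lines. -/
noncomputable def lineAngle {d : ℕ} (p q : RealProjectiveSpace d) : ℝ :=
  min (InnerProductGeometry.angle (Projectivization.rep p) (Projectivization.rep q))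
    (InnerProductGeometry.angle (Projectivization.rep p) (-Projectivization.rep q))

theorem min_angle_smul_left {d : ℕ} (v w : EuclideanSpace ℝ (Fin (d + 1))) {a : ℝ} (ha : a ≠ 0) :
    min (InnerProductGeometry.angle (a • v) w) (InnerProductGeometry.angle (a • v) (-w)) =
      min (InnerProductGeometry.angle v w) (InnerProductGeometry.angle v (-w)) := by
  rcases lt_or_gt_of_ne ha with h | h
  · rw [InnerProductGeometry.angle_smul_left_of_neg _ _ h,
      InnerProductGeometry.angle_smul_left_of_neg _ _ h, InnerProductGeometry.angle_neg_neg,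
      InnerProductGeometry.angle_neg_left, InnerProductGeometry.angle_neg_right, min_comm]
  · rw [InnerProductGeometry.angle_smul_left_of_pos _ _ h,
      InnerProductGeometry.angle_smul_left_of_pos _ _ h]

theorem min_angle_comm {d : ℕ} (v w : EuclideanSpace ℝ (Fin (d + 1))) :
    min (InnerProductGeometry.angle v w) (InnerProductGeometry.angle v (-w)) =
      min (InnerProductGeometry.angle w v) (InnerProductGeometry.angle w (-v)) := by
  rw [InnerProductGeometry.angle_neg_right, InnerProductGeometry.angle_neg_right,
    InnerProductGeometry.angle_comm]

theorem min_angle_triangle {d : ℕ} (u v w : EuclideanSpace ℝ (Fin (d + 1))) :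
    min (InnerProductGeometry.angle u w) (InnerProductGeometry.angle u (-w)) ≤
      min (InnerProductGeometry.angle u v) (InnerProductGeometry.angle u (-v)) +
        min (InnerProductGeometry.angle v w) (InnerProductGeometry.angle v (-w)) := by
  have h1 := InnerProductGeometry.angle_le_angle_add_angle u v w
  have h2 := InnerProductGeometry.angle_le_angle_add_angle u v (-w)
  have h3 := InnerProductGeometry.angle_le_angle_add_angle u (-v) w
  have h4 := InnerProductGeometry.angle_le_angle_add_angle u (-v) (-w)
  rw [InnerProductGeometry.angle_neg_neg] at h4
  rw [InnerProductGeometry.angle_neg_left, ← InnerProductGeometry.angle_neg_right] at h3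
  rcases min_cases (InnerProductGeometry.angle u v) (InnerProductGeometry.angle u (-v))
    with ⟨e, _⟩ | ⟨e, _⟩ <;>
  rcases min_cases (InnerProductGeometry.angle v w) (InnerProductGeometry.angle v (-w))
    with ⟨e', _⟩ | ⟨e', _⟩ <;> rw [e, e']
  · exact (min_le_left _ _).trans h1
  · exact (min_le_right _ _).trans h2
  · exact (min_le_right _ _).trans h4
  · exact (min_le_left _ _).trans h3

/-- The metric on `ℝP^d` in which the distance of two lines is the angle between them. -/
noncomputable instance instMetricSpace (d : ℕ) : MetricSpace (RealProjectiveSpace d) where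
  dist := lineAngle
  dist_self p := by
    unfold lineAngle
    rw [InnerProductGeometry.angle_self (Projectivization.rep_nonzero p)]
    exact min_eq_left (InnerProductGeometry.angle_nonneg _ _)
  dist_comm p q := min_angle_comm _ _
  dist_triangle p q r := min_angle_triangle _ _ _
  eq_of_dist_eq_zero {p q} h := by
    have key : ∃ a : ℝ, Projectivization.rep q = a • Projectivization.rep p := by
      have h' : min (InnerProductGeometry.angle (Projectivization.rep p) (Projectivization.rep q))
        (InnerProductGeometry.angle (Projectivization.rep p) (-Projectivization.rep q)) = 0 := h
      rcases min_choice
        (InnerProductGeometry.angle (Projectivization.rep p) (Projectivization.rep q))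
        (InnerProductGeometry.angle (Projectivization.rep p) (-Projectivization.rep q))
        with e | e <;> rw [e] at h' <;>
        obtain ⟨_, a, _, ha⟩ := InnerProductGeometry.angle_eq_zero_iff.1 h'
      · exact ⟨a, ha⟩
      · exact ⟨-a, by rw [neg_smul, ← ha, neg_neg]⟩
    obtain ⟨a, ha⟩ := key
    have e : Projectivization.mk ℝ (Projectivization.rep p) (Projectivization.rep_nonzero p) =
        Projectivization.mk ℝ (Projectivization.rep q) (Projectivization.rep_nonzero q) := by
      symm
      rw [Projectivization.mk_eq_mk_iff']
      exact ⟨a, ha.symm⟩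
    exact (Projectivization.mk_rep p).symm.trans (e.trans (Projectivization.mk_rep q))

/-- The metric on `ℝP^d` is the quotient metric of the geodesic metric on `S^d` under the
antipodal action. -/
theorem dist_ofSphere {d : ℕ} (x y : UnitSphere d) :
    dist (ofSphere x) (ofSphere y) =
      min (UnitSphere.geodesicDist x y) (UnitSphere.geodesicDist x (-y)) := by
  obtain ⟨a, ha⟩ := Projectivization.exists_smul_eq_mk_rep ℝ
    (x : EuclideanSpace ℝ (Fin (d + 1))) (ne_zero_of_mem_unit_sphere x)
  obtain ⟨b, hb⟩ := Projectivization.exists_smul_eq_mk_rep ℝ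
    (y : EuclideanSpace ℝ (Fin (d + 1))) (ne_zero_of_mem_unit_sphere y)
  change min (InnerProductGeometry.angle (Projectivization.rep (Projectivization.mk ℝ _ _))
    (Projectivization.rep (Projectivization.mk ℝ _ _)))
    (InnerProductGeometry.angle (Projectivization.rep (Projectivization.mk ℝ _ _))
    (-Projectivization.rep (Projectivization.mk ℝ _ _))) = _
  rw [← ha, ← hb, Units.smul_def, Units.smul_def, min_angle_smul_left _ _ a.ne_zero,
    min_angle_comm, min_angle_smul_left _ _ b.ne_zero, min_angle_comm]
  rfl

end RealProjectiveSpace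

/-! Lift an optimal code of n + 1 lines to points x_i of the sphere. Their evaluations on the
n-dimensional V are dependent: ∑ c_i f(x_i) = 0 with c ≠ 0 (`exists_eval_relation`). By oddness,
flipping the x_i with negative c_i makes the coefficients nonnegative, so no f in V is positive at
all points of nonzero weight. The flips do no harm: lines at distance at least p make both the angle
θ of their lifts and π - θ at least p, so both are at most π - p. Compactness provides the code
(`exists_optimal_code`). -/

open InnerProductGeometry in
theorem UnitSphere.geodesicDist_neg_right {d : ℕ} (x y : UnitSphere d) :
    UnitSphere.geodesicDist x (-y) = Real.pi - UnitSphere.geodesicDist x y :=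
  angle_neg_right _ _

open InnerProductGeometry in
theorem UnitSphere.geodesicDist_neg_left {d : ℕ} (x y : UnitSphere d) :
    UnitSphere.geodesicDist (-x) y = Real.pi - UnitSphere.geodesicDist x y :=
  angle_neg_left _ _

theorem UnitSphere.geodesicDist_self {d : ℕ} (x : UnitSphere d) :
    UnitSphere.geodesicDist x x = 0 :=
  InnerProductGeometry.angle_self (ne_zero_of_mem_unit_sphere x)

theorem UnitSphere.continuous_geodesicDist {d : ℕ} :
    Continuous fun q : UnitSphere d × UnitSphere d => UnitSphere.geodesicDist q.1 q.2 := by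
  rw [continuous_iff_continuousAt]
  intro q
  have h : ContinuousAt (fun q : UnitSphere d × UnitSphere d =>
      ((q.1 : EuclideanSpace ℝ (Fin (d + 1))), (q.2 : EuclideanSpace ℝ (Fin (d + 1))))) q := by
    fun_prop
  exact ContinuousAt.comp (f := fun q : UnitSphere d × UnitSphere d =>
      ((q.1 : EuclideanSpace ℝ (Fin (d + 1))), (q.2 : EuclideanSpace ℝ (Fin (d + 1)))))
    (InnerProductGeometry.continuousAt_angle (ne_zero_of_mem_unit_sphere q.1)
      (ne_zero_of_mem_unit_sphere q.2)) h

/-- With surjectivity of `ofSphere`, this lets compactness of the sphere replace that of ℝP^d. -/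
theorem RealProjectiveSpace.continuous_dist_ofSphere {d : ℕ} :
    Continuous fun q : UnitSphere d × UnitSphere d => dist (ofSphere q.1) (ofSphere q.2) := by
  simp only [dist_ofSphere, UnitSphere.geodesicDist_neg_right]
  exact UnitSphere.continuous_geodesicDist.min
    (continuous_const.sub UnitSphere.continuous_geodesicDist)

theorem RealProjectiveSpace.ofSphere_surjective {d : ℕ} :
    Function.Surjective (ofSphere : UnitSphere d → RealProjectiveSpace d) := by
  intro p
  have hp : ‖Projectivization.rep p‖ ≠ 0 := norm_ne_zero_iff.2 (Projectivization.rep_nonzero p)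
  refine ⟨⟨‖Projectivization.rep p‖⁻¹ • Projectivization.rep p, ?_⟩, ?_⟩
  · rw [mem_sphere_zero_iff_norm, norm_smul, norm_inv, norm_norm, inv_mul_cancel₀ hp]
  · refine Eq.trans ?_ (Projectivization.mk_rep p)
    exact (Projectivization.mk_eq_mk_iff' _ _ _ _ _).2 ⟨‖Projectivization.rep p‖⁻¹, rfl⟩

/-- The supremum defining `codeDistance` is attained in a space that is the image of a compact
space under a map along which the distance pulls back to a continuous function. -/
theorem exists_optimal_code {X Y : Type*} [TopologicalSpace X] [CompactSpace X] [Nonempty X]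
    [MetricSpace Y] {φ : X → Y} (hφ : Function.Surjective φ)
    (hcont : Continuous fun q : X × X => dist (φ q.1) (φ q.2)) {m : ℕ} (hm : 2 ≤ m) :
    ∃ x : Fin m → X, ∀ i j, i ≠ j → codeDistance Y m ≤ dist (φ (x i)) (φ (x j)) := by
  have hne : (Finset.univ : Finset (Fin m)).offDiag.Nonempty :=
    ⟨(⟨0, by omega⟩, ⟨1, by omega⟩), by simp⟩
  -- The least pairwise distance, continuous on the compact space X^m; a maximizer is an optimal
  -- code.
  let g : (Fin m → X) → ℝ := fun x =>
    (Finset.univ : Finset (Fin m)).offDiag.inf' hne fun q => dist (φ (x q.1)) (φ (x q.2))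
  have hg : Continuous g := Continuous.finset_inf'_apply hne fun q _ =>
    hcont.comp (f := fun x : Fin m → X => (x q.1, x q.2))
      ((continuous_apply q.1).prodMk (continuous_apply q.2))
  obtain ⟨x, -, hx⟩ := isCompact_univ.exists_isMaxOn Set.univ_nonempty hg.continuousOn
  refine ⟨x, fun i j hij => ?_⟩
  have hij' : g x ≤ dist (φ (x i)) (φ (x j)) :=
    Finset.inf'_le (fun q : Fin m × Fin m => dist (φ (x q.1)) (φ (x q.2)))
      (b := (i, j)) (by simpa using hij)
  -- Nonnegativity of the bound covers the case of no admissible ε, as in ℝP^0, where the supremum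
  -- is 0.
  refine (Real.sSup_le ?_ (Finset.le_inf' hne _ fun q _ => dist_nonneg)).trans hij'
  rintro ε ⟨-, y, hy⟩
  choose z hz using fun i => hφ (y i)
  refine le_trans (Finset.le_inf' hne _ fun q hq => ?_) (hx (Set.mem_univ z))
  simp only [hz]
  exact hy q.1 q.2 (by simpa using hq)

/-- Evaluations at more points than the dimension of a function space satisfy a linear relation. -/
theorem exists_eval_relation {X ι : Type*} [TopologicalSpace X] [Fintype ι]
    (V : Submodule ℝ C(X, ℝ)) [FiniteDimensional ℝ V]
    (h : Module.finrank ℝ V < Fintype.card ι) (x : ι → X) :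
    ∃ c : ι → ℝ, (∀ f ∈ V, ∑ i, c i * f (x i) = 0) ∧ ∃ i, c i ≠ 0 := by
  let e : ι → Module.Dual ℝ V := fun i =>
    { toFun := fun f => (f : C(X, ℝ)) (x i)
      map_add' := fun _ _ => rfl
      map_smul' := fun _ _ => rfl }
  -- The dual of V has the dimension of V, which is less than the number of evaluations.
  have he : ¬ LinearIndependent ℝ e := fun hli => by
    have := hli.fintype_card_le_finrank
    rw [Subspace.dual_finrank_eq] at this
    omega
  obtain ⟨c, hc, hi⟩ := Fintype.not_linearIndependent_iff.1 he
  refine ⟨c, fun f hf => ?_, hi⟩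
  simpa [e] using LinearMap.congr_fun hc ⟨f, hf⟩

theorem theorem1p1 (d n : ℕ) (hn : 1 ≤ n)
    (V : Submodule ℝ C(UnitSphere d, ℝ)) (hdim : Module.finrank ℝ V = n)
    (hodd : ∀ f ∈ V, ∀ x : UnitSphere d, f (-x) = -f x) :
    ∃ A : Set (UnitSphere d),
      UnitSphere.DiamAtMost A (Real.pi - codeDistance (RealProjectiveSpace d) (n + 1)) ∧
      ∀ f ∈ V, ¬ ∀ x ∈ A, 0 < f x := by
  have : Nonempty (UnitSphere d) := (NormedSpace.sphere_nonempty.2 zero_le_one).to_subtype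
  obtain ⟨x, hx⟩ := exists_optimal_code RealProjectiveSpace.ofSphere_surjective
    (RealProjectiveSpace.continuous_dist_ofSphere (d := d)) (m := n + 1) (by omega)
  -- `finrank` is 0 on infinite-dimensional spaces, so n ≥ 1 is essential here.
  have : FiniteDimensional ℝ V := Module.finite_of_finrank_pos (by omega)
  obtain ⟨c, hc, k, hk⟩ := exists_eval_relation V (by simp [hdim]) x
  let s : Fin (n + 1) → UnitSphere d := fun i => if 0 < c i then x i else -x i
  have hs : ∀ f ∈ V, ∀ i, |c i| * f (s i) = c i * f (x i) := by
    intro f hf i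
    by_cases h : 0 < c i
    · simp [s, h, abs_of_pos h]
    · simp [s, h, abs_of_nonpos (not_lt.1 h), hodd f hf]
  have hp : ∀ i j, i ≠ j → UnitSphere.geodesicDist (s i) (s j) ≤
      Real.pi - codeDistance (RealProjectiveSpace d) (n + 1) := by
    intro i j hij
    have h := hx i j hij
    rw [RealProjectiveSpace.dist_ofSphere, UnitSphere.geodesicDist_neg_right, le_min_iff] at h
    by_cases hi : 0 < c i <;> by_cases hj : 0 < c j <;>
      simp only [s, hi, hj, if_true, if_false, UnitSphere.geodesicDist_neg_right,
        UnitSphere.geodesicDist_neg_left] <;> linarith [h.1, h.2]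
  refine ⟨s '' {i | c i ≠ 0}, ?_, fun f hf hpos => ?_⟩
  · rintro _ ⟨i, -, rfl⟩ _ ⟨j, -, rfl⟩
    rcases eq_or_ne i j with rfl | hij
    -- The diagonal needs 0 ≤ π - p, which follows from the bound for any second index.
    · have : Nontrivial (Fin (n + 1)) := Fin.nontrivial_iff_two_le.2 (by omega)
      obtain ⟨j, hj⟩ := exists_ne i
      rw [UnitSphere.geodesicDist_self]
      exact (InnerProductGeometry.angle_nonneg _ _).trans (hp j i hj)
    · exact hp i j hij
  · have hsum := hc f hf
    simp only [← hs f hf] at hsum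
    refine hsum.not_gt (Finset.sum_pos' (fun i _ => ?_) ⟨k, Finset.mem_univ k, ?_⟩)
    · rcases eq_or_ne (c i) 0 with h | h
      · simp [h]
      · exact (mul_pos (abs_pos.2 h) (hpos _ ⟨i, h, rfl⟩)).le
    · exact mul_pos (abs_pos.2 hk) (hpos _ ⟨k, hk, rfl⟩)
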